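/- Let $\mathbb{F}_q$ be a finite field with $q$ elements, $A=\mathbb{F}_q[\theta]$, $K=\mathbb{F}_q(\theta)$, let $K_\infty=\mathbb{F}_q((1/\theta))$ be the completion of $K$ at the infinite place, and let $\overline{K}_\infty$ be an algebraic closure of $K_\infty$, equipped with the unique extension of the absolute value of $K_\infty$. Let $\tau$ denote the $q$-power Frobenius $x\mapsto x^q$ and let $K\{\tau\}$ be the skew polynomial ring in which $\tau c=c^q\tau$ for $c\in K$; its elements $\sum_i c_i\tau^i$ act on $\overline{K}_\infty$ by $x\mapsto\sum_i c_i x^{q^i}$. Let $r\ge 1$ and let $\phi:A\to K\{\tau\}$, $a\mapsto\phi_a$, be a Drinfeld module of rank $r$ over $K$, that is, a homomorphism of $\mathbb{F}_q$-algebras with \[\phi_\theta=\theta+a_1\tau+\dots+a_r\tau^r,\qquad a_1,\dots,a_r\in K,\ a_r\neq 0.\] Let $\exp_\phi:\overline{K}_\infty\to\overline{K}_\infty$, $\exp_\phi(x)=\sum_{i\ge 0}\alpha_i x^{q^i}$, be the exponential function of $\phi$, i.e. the unique everywhere convergent series of this form with $\alpha_0=1$ and $\exp_\phi(ax)=\phi_a(\exp_\phi(x))$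 for all $a\in A$ and $x\in\overline{K}_\infty$. Let $\Lambda_\phi=\ker(\exp_\phi)\subseteq\overline{K}_\infty$ be the period lattice of $\phi$, and for $a\in A$ let $\phi[a]=\{x\in\overline{K}_\infty : \phi_a(x)=0\}$ be the set of $a$-torsion points. Then, as subsets of $\overline{K}_\infty$, \[K_\infty(\Lambda_\phi)=\bigcup_{n\in\mathbb{N}}K_\infty(\phi[\theta^{n+1}]),\qquad \mathbb{N}=\{0,1,2,\dots\}.\] -/

import Mathlib

open scoped NNReal Polynomial WithZero Topology
open Filter

noncomputable section

namespace Drinfeld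

/-! ### The field `K_∞` and its algebraic closure -/

section Fields

variable (F : Type*) [Field F]

/-- `K_∞ = F((1/θ))`: the completion of `K = F(θ)` at the infinite place. The variable `θ` is
`RatFunc.X`. -/
abbrev KInfty : Type _ := @RatFunc.CompletionAtInfty F _ (Classical.decEq _)

instance : Algebra F (KInfty F) := Algebra.compHom _ (algebraMap F (RatFunc F))

instance : Algebra F[X] (KInfty F) := Algebra.compHom _ (algebraMap F[X] (RatFunc F))

instance : IsScalarTower F (RatFunc F) (KInfty F) := IsScalarTower.of_algebraMap_eq fun _ => rfl

instance : IsScalarTower F[X] (RatFunc F) (KInfty F) := IsScalarTower.of_algebraMap_eq fun _ => rfl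

instance : IsScalarTower F F[X] (KInfty F) := IsScalarTower.of_algebraMap_eq fun x => by
  rw [IsScalarTower.algebraMap_apply F (RatFunc F) (KInfty F),
    IsScalarTower.algebraMap_apply F[X] (RatFunc F) (KInfty F),
    IsScalarTower.algebraMap_apply F F[X] (RatFunc F)]

instance : CompleteSpace (KInfty F) := by
  let := Classical.decEq (RatFunc F)
  let := (RatFunc.inftyValued F).toUniformSpace
  exact inferInstanceAs (CompleteSpace (UniformSpace.Completion (RatFunc F)))

lemma valued_algebraMap (x : RatFunc F) :
    Valued.v (algebraMap (RatFunc F) (KInfty F) x) =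
      @RatFunc.inftyValuation F _ (Classical.decEq _) x := by
  let := Classical.decEq (RatFunc F)
  let := RatFunc.inftyValued F
  exact Valued.extensionValuation_apply_coe x

variable [Fintype F]

/-- The absolute value on `K_∞` is normalised by `|x| = q ^ (-v x)` with `v θ = -1`
and `q = #F`. -/
instance : Valuation.RankOne (Valued.v : Valuation (KInfty F) ℤᵐ⁰) where
  hom' := (WithZeroMulInt.toNNReal (e := (Fintype.card F : ℝ≥0)) (by simp)).comp
    MonoidWithZeroHom.ValueGroup₀.embedding
  strictMono' := (WithZeroMulInt.toNNReal_strictMono (by exact_mod_cast Fintype.one_lt_card)).comp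
    MonoidWithZeroHom.ValueGroup₀.embedding_strictMono
  exists_val_nontrivial := ⟨algebraMap _ _ RatFunc.X, by
    rw [valued_algebraMap]
    let := Classical.decEq (RatFunc F)
    simp only [RatFunc.inftyValuation.X]
    constructor <;> simp⟩

instance : NontriviallyNormedField (KInfty F) := Valued.toNontriviallyNormedField (KInfty F) ℤᵐ⁰

instance : IsUltrametricDist (KInfty F) :=
  inferInstanceAs (@IsUltrametricDist _ (Valued.toNormedField (KInfty F) ℤᵐ⁰).toDist)

lemma norm_algebraMap {x : RatFunc F} (hx : x ≠ 0) :
    ‖algebraMap (RatFunc F) (KInfty F) x‖ = (Fintype.card F : ℝ) ^ x.intDegree := by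
  have h1 : ‖algebraMap (RatFunc F) (KInfty F) x‖ =
      WithZeroMulInt.toNNReal (e := (Fintype.card F : ℝ≥0)) (by simp)
        (MonoidWithZeroHom.ValueGroup₀.embedding
          (Valued.v.restrict (algebraMap (RatFunc F) (KInfty F) x))) := rfl
  let := Classical.decEq (RatFunc F)
  have h2 : Valued.v (algebraMap (RatFunc F) (KInfty F) x) = WithZero.exp x.intDegree := by
    rw [valued_algebraMap, RatFunc.inftyValuation_apply, RatFunc.inftyValuation_of_nonzero _ hx]
  rw [h1, Valuation.embedding_restrict, h2, WithZeroMulInt.toNNReal_neg_apply _ (by simp)]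
  push_cast
  rfl

/-- An algebraic closure of `K_∞`, with the unique extension of the absolute value of `K_∞`. -/
abbrev KInftyBar : Type _ := AlgebraicClosure (KInfty F)

instance : NormedField (KInftyBar F) := spectralNorm.normedField (KInfty F) (KInftyBar F)

instance : NormedAlgebra (KInfty F) (KInftyBar F) := spectralNorm.normedAlgebra _ _

instance : IsUltrametricDist (KInftyBar F) :=
  IsUltrametricDist.isUltrametricDist_of_forall_norm_add_le_max_norm
    (isNonarchimedean_spectralNorm (K := KInfty F) (L := KInftyBar F))

end Fields

/-- A Drinfeld module of rank `r ≥ 1` over `K = F(θ)` (of generic characteristic), given by the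
coefficients of `φ_θ = θ + a₁ τ + ⋯ + a_r τ ^ r` with `a_r ≠ 0`; here `coeff i = a_i`, with
`a₀ = θ`, and `a_i = 0` for `i > r`. The algebra homomorphism `a ↦ φ_a` that these coefficients
determine is `DrinfeldModule.map`. -/
structure DrinfeldModule (F : Type*) [Field F] (r : ℕ) where
  /-- The coefficients of `φ_θ`. -/
  coeff : ℕ → RatFunc F
  rank_pos : 1 ≤ r
  coeff_zero : coeff 0 = RatFunc.X
  coeff_rank_ne_zero : coeff r ≠ 0
  coeff_eq_zero : ∀ i, r < i → coeff i = 0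

namespace DrinfeldModule

variable {F : Type*} [Field F] [Fintype F] {r : ℕ} (φ : DrinfeldModule F r)

/-- The operator `φ_θ = ∑ i, a_i τ ^ i`, where `τ` is the `q`-power Frobenius and `a_i`
acts by multiplication. -/
def mapTheta : Module.End F (KInftyBar F) :=
  ∑ i ∈ Finset.range (r + 1),
    Algebra.lmul F (KInftyBar F) (algebraMap (RatFunc F) (KInftyBar F) (φ.coeff i)) *
      (FiniteField.frobeniusAlgHom F (KInftyBar F)).toLinearMap ^ i

/-- The homomorphism of `F`-algebras `F[θ] → K{τ}, a ↦ φ_a`, the unique one that sends `θ` to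
`φ_θ`. Elements of `K{τ}` are regarded as the `F`-linear operators they define on the algebraic
closure of `K_∞`, composition being multiplication in `K{τ}`. -/
def map : F[X] →ₐ[F] Module.End F (KInftyBar F) := Polynomial.aeval φ.mapTheta

/-- The `a`-torsion points `φ[a] = {x | φ_a(x) = 0}`. -/
def torsion (a : F[X]) : Set (KInftyBar F) := {x | φ.map a x = 0}

/-- The coefficients `α_n` of the exponential `∑ α_n x ^ (q ^ n)` of `φ`: the solution of
`α₀ = 1` and `θ ^ (q ^ n) α_n = ∑ i ≤ n, a_{n - i} α_i ^ (q ^ (n - i))`, which is the comparison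
of coefficients in `exp_φ (θ x) = φ_θ (exp_φ x)` (see `theta_pow_mul_expCoeff`). -/
def expCoeff : ℕ → RatFunc F
  | 0 => 1
  | n + 1 => (∑ i : Fin (n + 1), φ.coeff (n + 1 - i) *
      expCoeff i ^ Fintype.card F ^ (n + 1 - i : ℕ)) /
        (RatFunc.X ^ Fintype.card F ^ (n + 1) - RatFunc.X)

lemma theta_pow_sub_ne_zero (n : ℕ) :
    (RatFunc.X ^ Fintype.card F ^ (n + 1) - RatFunc.X : RatFunc F) ≠ 0 := by
  have h := FiniteField.X_pow_card_pow_sub_X_ne_zero F (n := n + 1) (by simp) (Fintype.one_lt_card (α := F))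
  rw [← (IsFractionRing.injective F[X] (RatFunc F)).ne_iff] at h
  simpa using h

lemma theta_pow_mul_expCoeff (n : ℕ) :
    RatFunc.X ^ Fintype.card F ^ n * φ.expCoeff n =
      ∑ i ∈ Finset.range (n + 1), φ.coeff (n - i) * φ.expCoeff i ^ Fintype.card F ^ (n - i) := by
  cases n with
  | zero => simp [φ.coeff_zero, expCoeff]
  | succ n =>
    rw [Finset.sum_range_succ, Finset.sum_range]
    have h : φ.expCoeff (n + 1) * (RatFunc.X ^ Fintype.card F ^ (n + 1) - RatFunc.X) =
        ∑ i : Fin (n + 1), φ.coeff (n + 1 - i) *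
          φ.expCoeff i ^ Fintype.card F ^ (n + 1 - i : ℕ) := by
      rw [expCoeff]
      exact div_mul_cancel₀ _ (theta_pow_sub_ne_zero n)
    simp only [← h, Nat.sub_self, φ.coeff_zero, pow_zero, pow_one]
    ring

/-- The exponential function `exp_φ x = ∑ α_i x ^ (q ^ i)` of `φ`; it converges everywhere, see
`hasSum_exp`. -/
def exp (x : KInftyBar F) : KInftyBar F :=
  ∑' i : ℕ, algebraMap (RatFunc F) (KInftyBar F) (φ.expCoeff i) * x ^ Fintype.card F ^ i

lemma norm_algebraMap_bar (x : RatFunc F) :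
    ‖algebraMap (RatFunc F) (KInftyBar F) x‖ = ‖algebraMap (RatFunc F) (KInfty F) x‖ := by
  rw [IsScalarTower.algebraMap_apply (RatFunc F) (KInfty F) (KInftyBar F)]
  exact spectralNorm_extends _


lemma norm_theta_pow_sub (n : ℕ) :
    ‖algebraMap (RatFunc F) (KInftyBar F) (RatFunc.X ^ Fintype.card F ^ (n + 1) - RatFunc.X)‖ =
      (Fintype.card F : ℝ) ^ Fintype.card F ^ (n + 1) := by
  rw [norm_algebraMap_bar, norm_algebraMap F (theta_pow_sub_ne_zero n)]
  have h : (RatFunc.X ^ Fintype.card F ^ (n + 1) - RatFunc.X : RatFunc F) =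
      algebraMap F[X] (RatFunc F) (Polynomial.X ^ Fintype.card F ^ (n + 1) - Polynomial.X) := by
    simp
  rw [h, RatFunc.intDegree_polynomial,
    FiniteField.X_pow_card_pow_sub_X_natDegree_eq F (by simp) Fintype.one_lt_card, zpow_natCast]

lemma exists_norm_expCoeff_le : ∃ B ρ : ℝ, 1 ≤ B ∧ 0 < ρ ∧ ρ < 1 ∧ ∀ n,
    ‖algebraMap (RatFunc F) (KInftyBar F) (φ.expCoeff n)‖ * B ≤
      (B * ρ ^ n) ^ Fintype.card F ^ n := by
  set N : RatFunc F → ℝ := fun x => ‖algebraMap (RatFunc F) (KInftyBar F) x‖ with hN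
  set q := Fintype.card F with hq
  have hq2 : 2 ≤ q := Fintype.one_lt_card
  obtain ⟨B, hB1, hB⟩ : ∃ B : ℝ, 1 ≤ B ∧ ∀ j, N (φ.coeff j) ≤ B := by
    refine ⟨1 + ∑ j ∈ Finset.range (r + 1), N (φ.coeff j),
      le_add_of_nonneg_right (Finset.sum_nonneg fun _ _ => norm_nonneg _), fun j => ?_⟩
    by_cases hj : r < j
    · simp only [φ.coeff_eq_zero j hj, hN, map_zero, norm_zero]
      have := Finset.sum_nonneg (s := Finset.range (r + 1))
        (fun j _ => norm_nonneg (algebraMap (RatFunc F) (KInftyBar F) (φ.coeff j)))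
      linarith
    · have := Finset.single_le_sum (s := Finset.range (r + 1)) (f := fun j => N (φ.coeff j))
        (fun j _ => norm_nonneg _) (Finset.mem_range.2 (by omega : j < r + 1))
      linarith
  have hr := φ.rank_pos
  obtain ⟨ρ, hρ0, hρ1, hρ⟩ : ∃ ρ : ℝ, 0 < ρ ∧ ρ < 1 ∧ 1 / 2 ≤ ρ ^ r := by
    have hr' : (1 : ℝ) ≤ r := by exact_mod_cast hr
    have h2 : 1 / (2 * (r : ℝ)) ≤ 1 / 2 := by
      apply one_div_le_one_div_of_le <;> linarith
    have h3 : 0 < 1 / (2 * (r : ℝ)) := by positivity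
    refine ⟨1 + -(1 / (2 * r)), by linarith, by linarith, ?_⟩
    refine le_trans (le_of_eq ?_) (one_add_mul_le_pow (by linarith) r)
    field_simp
    norm_num
  refine ⟨B, ρ, hB1, hρ0, hρ1, fun n => ?_⟩
  change N (φ.expCoeff n) * B ≤ _
  have hB0 : 0 < B := by linarith
  induction n using Nat.strong_induction_on with
  | _ n ih =>
    cases n with
    | zero => simp [hN, expCoeff]
    | succ n =>
      have hq0 : (0 : ℝ) < (q : ℝ) ^ q ^ (n + 1) := by positivity
      have key : ∀ i ∈ (Finset.univ : Finset (Fin (n + 1))),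
          ‖algebraMap (RatFunc F) (KInftyBar F) (φ.coeff (n + 1 - i) *
            φ.expCoeff i ^ q ^ (n + 1 - i : ℕ))‖ ≤
              (q : ℝ) ^ q ^ (n + 1) * (B * ρ ^ (n + 1)) ^ q ^ (n + 1) / B := by
        intro i _
        by_cases hi : r < n + 1 - i
        · rw [φ.coeff_eq_zero _ hi]
          simp only [zero_mul, map_zero, norm_zero]
          positivity
        · obtain ⟨j, hj⟩ : ∃ j, n + 1 = i + j := ⟨n + 1 - i, by omega⟩
          have hji : n + 1 - i = j := by omega
          rw [hji] at hi ⊢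
          have hj0 : j ≠ 0 := by omega
          rw [map_mul, map_pow, norm_mul, norm_pow, le_div_iff₀ hB0, ← mul_pow]
          have hqj : 2 ≤ q ^ j := hq2.trans (Nat.le_self_pow hj0 q)
          have hs : 0 ≤ N (φ.expCoeff i) := norm_nonneg _
          calc N (φ.coeff j) * N (φ.expCoeff i) ^ q ^ j * B
              ≤ B * N (φ.expCoeff i) ^ q ^ j * B := by gcongr; exact hB j
            _ = B ^ 2 * N (φ.expCoeff i) ^ q ^ j := by ring
            _ ≤ B ^ q ^ j * N (φ.expCoeff i) ^ q ^ j := by gcongr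
            _ = (N (φ.expCoeff i) * B) ^ q ^ j := by rw [mul_pow]; ring
            _ ≤ ((B * ρ ^ (i : ℕ)) ^ q ^ (i : ℕ)) ^ q ^ j := by
              gcongr
              exact ih i (by omega)
            _ = (B * ρ ^ (i : ℕ)) ^ q ^ (n + 1) := by
              rw [← pow_mul, ← pow_add, show (i : ℕ) + j = n + 1 from hj.symm]
            _ ≤ (q * (B * ρ ^ (n + 1))) ^ q ^ (n + 1) := by
              refine pow_le_pow_left₀ (by positivity) ?_ _
              have h1 : ρ ^ r ≤ ρ ^ j := pow_le_pow_of_le_one hρ0.le hρ1.le (by omega)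
              have h2 : (2 : ℝ) ≤ q := by exact_mod_cast hq2
              have h3 : 1 ≤ q * ρ ^ j := by nlinarith
              have h4 : 0 ≤ B * ρ ^ (i : ℕ) := by positivity
              have h5 : ρ ^ (n + 1) = ρ ^ (i : ℕ) * ρ ^ j := by rw [← pow_add]; exact congrArg _ hj
              rw [h5]
              nlinarith
      have := IsUltrametricDist.norm_sum_le_of_forall_le_of_nonneg (by positivity) key
      rw [← map_sum] at this
      have h5 : N (φ.expCoeff (n + 1)) ≤ (B * ρ ^ (n + 1)) ^ q ^ (n + 1) / B := by
        simp only [hN]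
        rw [expCoeff, map_div₀, norm_div, norm_theta_pow_sub, div_le_iff₀ hq0]
        refine this.trans (le_of_eq ?_)
        ring
      rwa [le_div_iff₀ hB0] at h5

lemma summable_exp (x : KInftyBar F) : Summable fun i : ℕ =>
    algebraMap (RatFunc F) (KInftyBar F) (φ.expCoeff i) * x ^ Fintype.card F ^ i := by
  have hx : IsIntegral (KInfty F) x := Algebra.IsIntegral.isIntegral x
  have := IntermediateField.adjoin.finiteDimensional hx
  let E := IntermediateField.adjoin (KInfty F) {x}
  let y : E := ⟨x, IntermediateField.mem_adjoin_simple_self _ x⟩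
  have : CompleteSpace E := FiniteDimensional.complete (KInfty F) E
  let f : ℕ → E := fun i =>
    algebraMap (KInfty F) E (algebraMap (RatFunc F) (KInfty F) (φ.expCoeff i)) *
      y ^ Fintype.card F ^ i
  have hf : ∀ i, (f i : KInftyBar F) =
      algebraMap (RatFunc F) (KInftyBar F) (φ.expCoeff i) * x ^ Fintype.card F ^ i := fun i => rfl
  suffices h : Summable f by
    have := h.map (algebraMap E (KInftyBar F)) continuous_subtype_val
    exact this
  refine NonarchimedeanAddGroup.summable_of_tendsto_cofinite_zero ?_
  rw [Nat.cofinite_eq_atTop]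
  obtain ⟨B, ρ, hB1, hρ0, hρ1, h⟩ := φ.exists_norm_expCoeff_le
  have hlim : Tendsto (fun n : ℕ => (B * ρ ^ n * ‖x‖)) atTop (𝓝 0) := by
    simpa using ((tendsto_pow_atTop_nhds_zero_of_lt_one hρ0.le hρ1).const_mul B).mul_const ‖x‖
  refine squeeze_zero_norm' ?_ (tendsto_pow_atTop_nhds_zero_of_lt_one
    (by norm_num : (0 : ℝ) ≤ 1 / 2) (by norm_num))
  filter_upwards [hlim.eventually_le_const (by norm_num : (0 : ℝ) < 1 / 2)] with n hn
  have h0 : ‖f n‖ = ‖algebraMap (RatFunc F) (KInftyBar F) (φ.expCoeff n)‖ *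
      ‖x‖ ^ Fintype.card F ^ n := by
    rw [show ‖f n‖ = ‖(f n : KInftyBar F)‖ from rfl, hf, norm_mul, norm_pow]
  have h1 := norm_nonneg (algebraMap (RatFunc F) (KInftyBar F) (φ.expCoeff n))
  calc ‖f n‖ ≤ (B * ρ ^ n) ^ Fintype.card F ^ n * ‖x‖ ^ Fintype.card F ^ n := by
        rw [h0]
        gcongr
        exact (le_mul_of_one_le_right h1 hB1).trans (h n)
    _ = (B * ρ ^ n * ‖x‖) ^ Fintype.card F ^ n := by rw [← mul_pow]
    _ ≤ (1 / 2) ^ Fintype.card F ^ n := by gcongr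
    _ ≤ (1 / 2) ^ n := pow_le_pow_of_le_one (by norm_num) (by norm_num)
        (Nat.lt_pow_self Fintype.one_lt_card).le

lemma hasSum_exp (x : KInftyBar F) : HasSum (fun i : ℕ =>
    algebraMap (RatFunc F) (KInftyBar F) (φ.expCoeff i) * x ^ Fintype.card F ^ i) (φ.exp x) :=
  (φ.summable_exp x).hasSum

lemma frobenius_pow_apply (j : ℕ) (x : KInftyBar F) :
    ((FiniteField.frobeniusAlgHom F (KInftyBar F)).toLinearMap ^ j) x =
      x ^ Fintype.card F ^ j := by
  induction j with
  | zero => simp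
  | succ j ih => rw [pow_succ', Module.End.mul_apply, ih]; simp [← pow_mul, pow_succ]

lemma mapTheta_apply (x : KInftyBar F) : φ.mapTheta x = ∑ i ∈ Finset.range (r + 1),
    algebraMap (RatFunc F) (KInftyBar F) (φ.coeff i) * x ^ Fintype.card F ^ i := by
  simp only [mapTheta, LinearMap.sum_apply, Module.End.mul_apply, frobenius_pow_apply]
  rfl

/-- The exponential function as an `F`-linear map. -/
def expLinear : KInftyBar F →ₗ[F] KInftyBar F where
  toFun := φ.exp
  map_add' x y := by
    refine (φ.hasSum_exp (x + y)).unique ?_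
    convert (φ.hasSum_exp x).add (φ.hasSum_exp y) using 2 with i
    rw [← mul_add]
    rw [← frobenius_pow_apply, map_add, frobenius_pow_apply, frobenius_pow_apply]
  map_smul' c x := by
    refine (φ.hasSum_exp (c • x)).unique ?_
    have := (φ.hasSum_exp x).mul_left (algebraMap F (KInftyBar F) c)
    rw [RingHom.id_apply, Algebra.smul_def c (φ.exp x)]
    refine this.congr_fun fun i => ?_
    rw [← frobenius_pow_apply, map_smul, frobenius_pow_apply, mul_smul_comm, Algebra.smul_def]

lemma exp_theta_mul (x : KInftyBar F) :
    φ.exp (algebraMap F[X] (KInftyBar F) Polynomial.X * x) = φ.mapTheta (φ.exp x) := by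
  set ι := algebraMap (RatFunc F) (KInftyBar F)
  set q := Fintype.card F
  have hX : algebraMap F[X] (KInftyBar F) Polynomial.X = ι RatFunc.X := by
    rw [IsScalarTower.algebraMap_apply F[X] (RatFunc F) (KInftyBar F), RatFunc.algebraMap_X]
  refine (φ.hasSum_exp _).unique ?_
  rw [mapTheta_apply]
  have h1 : ∀ j, HasSum (fun n : ℕ => if j ≤ n then
      ι (φ.coeff j * φ.expCoeff (n - j) ^ q ^ j) * x ^ q ^ n else 0)
        (ι (φ.coeff j) * φ.exp x ^ q ^ j) := by
    intro j
    have hF := (φ.hasSum_exp x).map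
      ((FiniteField.frobeniusAlgHom F (KInftyBar F)).toLinearMap ^ j)
      (by
        have h : Continuous fun y : KInftyBar F => y ^ q ^ j := continuous_pow _
        exact h.congr fun y => (frobenius_pow_apply j y).symm)
    have := hF.mul_left (ι (φ.coeff j))
    rw [frobenius_pow_apply] at this
    rw [← (add_left_injective j).hasSum_iff]
    · refine this.congr_fun fun n => ?_
      simp only [Function.comp_apply]
      rw [if_pos (Nat.le_add_left j n), Nat.add_sub_cancel, frobenius_pow_apply, mul_pow, map_mul,
        map_pow, ← pow_mul, ← pow_add, mul_assoc]
    · intro n hn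
      rw [if_neg]
      exact fun hjn => hn ⟨n - j, Nat.sub_add_cancel hjn⟩
  have h2 := hasSum_sum fun j (_ : j ∈ Finset.range (r + 1)) => h1 j
  convert h2 using 2 with n
  rw [hX, mul_pow, ← mul_assoc, ← map_pow, ← map_mul, mul_comm (φ.expCoeff n),
    theta_pow_mul_expCoeff, ← Finset.sum_range_reflect, map_sum, Finset.sum_mul,
    ← Finset.sum_filter]
  symm
  rw [Finset.sum_subset (s₂ := Finset.range (n + 1))]
  · refine Finset.sum_congr rfl fun j hj => ?_
    have hj := Finset.mem_range.1 hj
    rw [show n + 1 - 1 - j = n - j by omega, show n - (n - j) = j by omega]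
  · intro j hj
    simp only [Finset.mem_filter, Finset.mem_range] at hj ⊢
    omega
  · intro j hj hj'
    simp only [Finset.mem_filter, Finset.mem_range] at hj hj'
    rw [φ.coeff_eq_zero j (by omega)]
    simp

/-- The functional equation `exp_φ (a x) = φ_a (exp_φ x)`. -/
lemma exp_mul (a : F[X]) (x : KInftyBar F) :
    φ.exp (algebraMap F[X] (KInftyBar F) a * x) = φ.map a (φ.exp x) := by
  induction a using Polynomial.induction_on generalizing x with
  | C c =>
    rw [← Polynomial.algebraMap_eq, AlgHom.commutes, Module.algebraMap_end_apply,
      ← IsScalarTower.algebraMap_apply, ← Algebra.smul_def]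
    exact φ.expLinear.map_smul c x
  | add a b ha hb =>
    rw [map_add, add_mul, map_add, LinearMap.add_apply, ← ha, ← hb]
    exact φ.expLinear.map_add _ _
  | monomial n c ih =>
    rw [pow_succ, ← mul_assoc, map_mul, mul_assoc, ih, exp_theta_mul,
      map_mul φ.map, Module.End.mul_apply]
    simp [map]

/-- The period lattice `Λ_φ`: the kernel of the exponential function, an `F[θ]`-submodule. -/
def periodLattice : Submodule F[X] (KInftyBar F) where
  carrier := {x | φ.exp x = 0}
  add_mem' {x y} hx hy := (φ.expLinear.map_add x y).trans (by
    change φ.exp x + φ.exp y = 0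
    rw [hx.out, hy.out, add_zero])
  zero_mem' := φ.expLinear.map_zero
  smul_mem' a x hx := by
    change φ.exp (a • x) = 0
    rw [Algebra.smul_def, exp_mul, hx.out, map_zero]

end DrinfeldModule
end Drinfeld

end

/-! The bridge between periods and torsion is `exp_φ`, used over finite extensions E of K_∞. Such an
E is complete, hence closed, although the algebraic closure is not complete. So `exp_φ` maps E to E
(`exp_mem`), and on a small ball it is a perturbation of the identity that can be inverted inside E
(`exists_ball_exp_bijOn`).

Torsion from periods: `exp_φ` is surjective, so a torsion point of φ[a] is exp_φ(x) with l = ax a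
period. Then x = l/a lies in K_∞(l), and so does exp_φ(x).

Periods from torsion: for a period l and large n, l/θ^(n+1) lies in the small ball and y =
exp_φ(l/θ^(n+1)) is θ^(n+1)-torsion. Inverting `exp_φ` over K_∞(y) puts l/θ^(n+1), hence l, in
K_∞(y). -/

/-- The logarithmic derivative p'(0)/p(0) is the sum of 1/(0 - z) over the roots z, so by the
ultrametric inequality some term is at least as large as the sum. This replaces a Newton polygon
argument. -/
lemma Polynomial.exists_isRoot_norm_mul_le {L : Type*} [NormedField L] [IsUltrametricDist L]
    [IsAlgClosed L] (p : L[X]) (hp : p.derivative.eval 0 ≠ 0) :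
    ∃ z, p.IsRoot z ∧ ‖p.derivative.eval 0‖ * ‖z‖ ≤ ‖p.eval 0‖ := by
  by_cases h0 : p.eval 0 = 0
  · exact ⟨0, h0, by simp⟩
  have h := (IsAlgClosed.splits p).eval_derivative_div_eval_of_ne_zero h0
  -- Without roots the sum would be empty, forcing p'(0) = 0.
  have hne : p.roots ≠ 0 := by
    intro hr
    rw [hr, Multiset.map_zero, Multiset.sum_zero, div_eq_zero_iff] at h
    exact h.elim hp h0
  obtain ⟨z, hz, hle⟩ := IsUltrametricDist.exists_norm_multiset_sum_le p.roots
    (f := fun z => 1 / (0 - z))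
  have hz := Polynomial.isRoot_of_mem_roots (hz hne)
  have hz0 : z ≠ 0 := by
    rintro rfl
    exact h0 hz
  refine ⟨z, hz, ?_⟩
  rw [← h, norm_div, norm_div, zero_sub, norm_neg, norm_one, div_le_div_iff₀ (norm_pos_iff.2 h0)
    (norm_pos_iff.2 hz0), one_mul] at hle
  exact hle

/-! ### Norms and finite extensions of K_∞ -/

namespace Drinfeld

section

variable {F : Type*} [Field F]

lemma norm_X_pow [Fintype F] (n : ℕ) :
    ‖algebraMap F[X] (KInftyBar F) (Polynomial.X ^ n)‖ = (Fintype.card F : ℝ) ^ n := by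
  rw [IsScalarTower.algebraMap_apply F[X] (RatFunc F) (KInftyBar F),
    DrinfeldModule.norm_algebraMap_bar, norm_algebraMap F (by simp [RatFunc.X_ne_zero])]
  simp [-map_pow, RatFunc.intDegree_polynomial]

lemma algebraMap_ratFunc_mem (E : IntermediateField (KInfty F) (KInftyBar F)) (c : RatFunc F) :
    algebraMap (RatFunc F) (KInftyBar F) c ∈ E := by
  rw [IsScalarTower.algebraMap_apply (RatFunc F) (KInfty F) (KInftyBar F)]
  exact E.algebraMap_mem _

lemma algebraMap_poly_mem (E : IntermediateField (KInfty F) (KInftyBar F)) (a : F[X]) :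
    algebraMap F[X] (KInftyBar F) a ∈ E := by
  rw [IsScalarTower.algebraMap_apply F[X] (RatFunc F) (KInftyBar F)]
  exact algebraMap_ratFunc_mem E _

lemma algebraMap_poly_ne_zero {a : F[X]} (ha : a ≠ 0) : algebraMap F[X] (KInftyBar F) a ≠ 0 := by
  rw [IsScalarTower.algebraMap_apply F[X] (RatFunc F) (KInftyBar F)]
  simpa using ha

lemma isClosed_intermediateField [Fintype F] (E : IntermediateField (KInfty F) (KInftyBar F))
    [FiniteDimensional (KInfty F) E] : IsClosed (E : Set (KInftyBar F)) := by
  have : FiniteDimensional (KInfty F) E.toSubalgebra.toSubmodule := ‹_›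
  exact Submodule.closed_of_finiteDimensional E.toSubalgebra.toSubmodule

lemma finiteDimensional_adjoin_simple (x : KInftyBar F) :
    FiniteDimensional (KInfty F) (IntermediateField.adjoin (KInfty F) {x}) :=
  IntermediateField.adjoin.finiteDimensional (Algebra.IsIntegral.isIntegral x)

end

/-! ### The exponential on a small ball -/

namespace DrinfeldModule

variable {F : Type*} [Field F] [Fintype F] {r : ℕ} (φ : DrinfeldModule F r)

lemma exp_zero : φ.exp 0 = 0 := φ.expLinear.map_zero

lemma expCoeff_zero : φ.expCoeff 0 = 1 := by rw [expCoeff]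

lemma exp_sub (x y : KInftyBar F) : φ.exp (x - y) = φ.exp x - φ.exp y := φ.expLinear.map_sub x y

/-- The partial sums lie in E because the α_i lie in K, and E is closed. -/
lemma exp_mem (E : IntermediateField (KInfty F) (KInftyBar F)) [FiniteDimensional (KInfty F) E]
    {x : KInftyBar F} (hx : x ∈ E) : φ.exp x ∈ E :=
  (isClosed_intermediateField E).mem_of_tendsto (φ.hasSum_exp x) <| Eventually.of_forall fun _ =>
    sum_mem fun _ _ => mul_mem (algebraMap_ratFunc_mem E _) (pow_mem hx _)

/-- The exponential is close to the identity on a small ball. -/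
lemma exists_norm_exp_sub_self_le : ∃ R : ℝ, 0 < R ∧ ∀ x : KInftyBar F, ‖x‖ ≤ R →
    ‖φ.exp x - x‖ ≤ ‖x‖ / 2 := by
  obtain ⟨B, ρ, hB1, hρ0, hρ1, h⟩ := φ.exists_norm_expCoeff_le
  have hB0 : 0 < B := by linarith
  have hq : 1 < Fintype.card F := Fintype.one_lt_card
  -- For i ≥ 1 the i-th term is at most (B‖x‖)^(q^i) ≤ (B‖x‖)^2, and this radius makes the last
  -- quantity at most ‖x‖/2.
  refine ⟨1 / (2 * B ^ 2), by positivity, fun x hx => ?_⟩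
  have hx2 : 2 * B ^ 2 * ‖x‖ ≤ 1 := by
    rw [le_div_iff₀ (by positivity)] at hx
    linarith
  have hBx : B * ‖x‖ ≤ 1 := by nlinarith [norm_nonneg x, mul_nonneg hB0.le (norm_nonneg x)]
  have hs := (hasSum_nat_add_iff' 1).2 (φ.hasSum_exp x)
  simp only [Finset.range_one, Finset.sum_singleton, pow_zero, pow_one, expCoeff_zero, map_one,
    one_mul] at hs
  have hball : φ.exp x - x ∈ Metric.closedBall (0 : KInftyBar F) (‖x‖ / 2) := by
    refine Metric.isClosed_closedBall.mem_of_tendsto hs (Eventually.of_forall fun s => ?_)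
    rw [mem_closedBall_zero_iff]
    refine IsUltrametricDist.norm_sum_le_of_forall_le_of_nonneg (by positivity) fun i _ => ?_
    have hN := norm_nonneg (algebraMap (RatFunc F) (KInftyBar F) (φ.expCoeff (i + 1)))
    have h2 : 2 ≤ Fintype.card F ^ (i + 1) := Nat.succ_le_of_lt (hq.trans_le (Nat.le_self_pow i.succ_ne_zero _))
    calc ‖algebraMap (RatFunc F) (KInftyBar F) (φ.expCoeff (i + 1)) *
          x ^ Fintype.card F ^ (i + 1)‖
        = ‖algebraMap (RatFunc F) (KInftyBar F) (φ.expCoeff (i + 1))‖ *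
          ‖x‖ ^ Fintype.card F ^ (i + 1) := by rw [norm_mul, norm_pow]
      _ ≤ (B * ρ ^ (i + 1)) ^ Fintype.card F ^ (i + 1) * ‖x‖ ^ Fintype.card F ^ (i + 1) := by
        gcongr
        exact (le_mul_of_one_le_right hN hB1).trans (h (i + 1))
      _ ≤ (B * 1) ^ Fintype.card F ^ (i + 1) * ‖x‖ ^ Fintype.card F ^ (i + 1) := by
        gcongr
        exact pow_le_one₀ hρ0.le hρ1.le
      _ = (B * ‖x‖) ^ Fintype.card F ^ (i + 1) := by rw [mul_one, mul_pow]
      _ ≤ (B * ‖x‖) ^ 2 := pow_le_pow_of_le_one (by positivity) hBx h2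
      _ ≤ ‖x‖ / 2 := by nlinarith [norm_nonneg x]
  simpa using hball

/-- On a small ball the exponential is injective, and surjective over every finite extension
of `K_∞`. -/
lemma exists_ball_exp_bijOn : ∃ R : ℝ, 0 < R ∧
    (∀ x : KInftyBar F, ‖x‖ ≤ R → φ.exp x = 0 → x = 0) ∧
    (∀ x : KInftyBar F, ‖x‖ ≤ R → ‖φ.exp x‖ ≤ ‖x‖) ∧
    ∀ (E : IntermediateField (KInfty F) (KInftyBar F)) [FiniteDimensional (KInfty F) E],
      ∀ y ∈ E, ‖y‖ ≤ R → ∃ x ∈ E, ‖x‖ ≤ R ∧ φ.exp x = y := by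
  obtain ⟨R, hR, h⟩ := φ.exists_norm_exp_sub_self_le
  have hle : ∀ x : KInftyBar F, ‖x‖ ≤ R → ‖φ.exp x‖ ≤ ‖x‖ := fun x hx => by
    have := IsUltrametricDist.norm_add_le_max (φ.exp x - x) x
    rw [sub_add_cancel] at this
    exact this.trans (max_le ((h x hx).trans (by linarith [norm_nonneg x])) le_rfl)
  refine ⟨R, hR, fun x hx hx0 => ?_, hle, fun E _ y hyE hy => ?_⟩
  · have := h x hx
    rw [hx0, zero_sub, norm_neg] at this
    exact norm_le_zero_iff.1 (by linarith)
  -- Successive approximation: exp_φ(t_n) = t_n - t_(n+1) telescopes, and t_n shrinks geometrically,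
  -- so ∑ t_n is the preimage of y.
  · let t : ℕ → KInftyBar F := fun n => (fun x => x - φ.exp x)^[n] y
    have ht : ∀ n, t (n + 1) = t n - φ.exp (t n) := fun n => Function.iterate_succ_apply' _ _ _
    have htE : ∀ n, t n ∈ E := fun n => by
      induction n with
      | zero => exact hyE
      | succ n ih => rw [ht]; exact sub_mem ih (φ.exp_mem E ih)
    have htn : ∀ n, ‖t n‖ ≤ ‖y‖ * (1 / 2) ^ n := fun n => by
      induction n with
      | zero => simp [t]
      | succ n ih =>
        have hR' : ‖t n‖ ≤ R := ih.trans ((mul_le_of_le_one_right (norm_nonneg y)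
          (pow_le_one₀ (by norm_num) (by norm_num))).trans hy)
        rw [ht, norm_sub_rev, pow_succ]
        linarith [h _ hR']
    have hgeom : Tendsto (fun n : ℕ => ‖y‖ * (1 / 2 : ℝ) ^ n) atTop (𝓝 0) := by
      simpa using (tendsto_pow_atTop_nhds_zero_of_lt_one (by norm_num : (0 : ℝ) ≤ 1 / 2)
        (by norm_num)).const_mul ‖y‖
    have ht0 : Tendsto t atTop (𝓝 0) := squeeze_zero_norm htn hgeom
    have : CompleteSpace E := FiniteDimensional.complete (KInfty F) E
    have hsum : Summable fun n => (⟨t n, htE n⟩ : E) := by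
      refine NonarchimedeanAddGroup.summable_of_tendsto_cofinite_zero ?_
      rw [Nat.cofinite_eq_atTop]
      exact squeeze_zero_norm htn hgeom
    obtain ⟨x, hx⟩ := hsum
    have hx : HasSum t (x : KInftyBar F) :=
      hx.map (algebraMap E (KInftyBar F)) continuous_subtype_val
    have hlim := hx.tendsto_sum_nat
    have hexp : ∀ n, φ.exp (∑ i ∈ Finset.range n, t i) = y - t n := fun n => by
      induction n with
      | zero => simp [t, exp_zero]
      | succ n ih =>
        rw [Finset.sum_range_succ, ht]
        refine (φ.expLinear.map_add _ _).trans ?_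
        change φ.exp _ + φ.exp _ = _
        rw [ih]
        ring
    have hxR : ‖(x : KInftyBar F)‖ ≤ R := by
      rw [← mem_closedBall_zero_iff]
      refine Metric.isClosed_closedBall.mem_of_tendsto hx (Eventually.of_forall fun s => ?_)
      rw [mem_closedBall_zero_iff]
      exact IsUltrametricDist.norm_sum_le_of_forall_le_of_nonneg hR.le fun i _ =>
        (htn i).trans ((mul_le_of_le_one_right (norm_nonneg y)
          (pow_le_one₀ (by norm_num) (by norm_num))).trans hy)
    refine ⟨x, x.2, hxR, ?_⟩
    have hd : Tendsto (fun n => ‖(x : KInftyBar F) - ∑ i ∈ Finset.range n, t i‖) atTop (𝓝 0) := by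
      simpa using (hlim.const_sub (x : KInftyBar F)).norm
    -- Continuity of `exp_φ` is needed only at 0, where it follows from `hle`; additivity transfers
    -- it to x.
    have h1 : Tendsto (fun n => φ.exp ((x : KInftyBar F) - ∑ i ∈ Finset.range n, t i))
        atTop (𝓝 0) := by
      refine squeeze_zero_norm' ?_ hd
      filter_upwards [hd.eventually_le_const hR] with n hn using hle _ hn
    have h2 : Tendsto (fun n => φ.exp ((x : KInftyBar F) - ∑ i ∈ Finset.range n, t i))
        atTop (𝓝 (φ.exp x - (y - 0))) := by
      simp only [exp_sub, hexp]
      exact (ht0.const_sub y).const_sub _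
    have := tendsto_nhds_unique h2 h1
    rwa [sub_zero, sub_eq_zero] at this

/-! ### Small division points and surjectivity of the exponential -/

/-- Every point has a small preimage under `φ_θ`. -/
lemma exists_mapTheta_eq_norm_le (y : KInftyBar F) :
    ∃ z, φ.mapTheta z = y ∧ ‖z‖ ≤ ‖y‖ / Fintype.card F := by
  have hq : 1 < Fintype.card F := Fintype.one_lt_card
  let p : (KInftyBar F)[X] := ∑ i ∈ Finset.range (r + 1),
    Polynomial.C (algebraMap (RatFunc F) (KInftyBar F) (φ.coeff i)) *
      Polynomial.X ^ Fintype.card F ^ i - Polynomial.C y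
  have hp : ∀ z, p.eval z = φ.mapTheta z - y := fun z => by
    simp [p, mapTheta_apply, Polynomial.eval_finsetSum]
  have hp' : p.derivative.eval 0 = algebraMap F[X] (KInftyBar F) (Polynomial.X ^ 1) := by
    have hX : algebraMap F[X] (KInftyBar F) (Polynomial.X ^ 1) =
        algebraMap (RatFunc F) (KInftyBar F) RatFunc.X := by
      rw [pow_one, IsScalarTower.algebraMap_apply F[X] (RatFunc F) (KInftyBar F),
        RatFunc.algebraMap_X]
    -- In characteristic p the terms with i ≥ 1 have zero derivative, so p'(0) = a₀ = θ, of norm q;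
    -- this is the factor gained in the bound on z.
    have hcard : (Fintype.card F : KInftyBar F) = 0 := by
      rw [← map_natCast (algebraMap F (KInftyBar F)), FiniteField.cast_card_eq_zero, map_zero]
    rw [hX, ← φ.coeff_zero]
    simp [p, Finset.sum_range_succ', Polynomial.derivative_X_pow, hcard]
  have hn : ‖p.derivative.eval 0‖ = Fintype.card F := by rw [hp', norm_X_pow, pow_one]
  obtain ⟨z, hz, hle⟩ := p.exists_isRoot_norm_mul_le (by
    rw [← norm_ne_zero_iff, hn]
    exact_mod_cast (by omega : Fintype.card F ≠ 0))
  refine ⟨z, sub_eq_zero.1 ((hp z).symm.trans hz), ?_⟩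
  rw [hn, hp, map_zero, zero_sub, norm_neg] at hle
  rw [le_div_iff₀ (by positivity)]
  linarith

lemma map_X_pow_succ (n : ℕ) (x : KInftyBar F) :
    φ.map (Polynomial.X ^ (n + 1)) x = φ.map (Polynomial.X ^ n) (φ.mapTheta x) := by
  simp [map, pow_succ]

lemma exists_map_X_pow_eq_norm_le (y : KInftyBar F) (n : ℕ) :
    ∃ z, φ.map (Polynomial.X ^ n) z = y ∧ ‖z‖ ≤ ‖y‖ / (Fintype.card F) ^ n := by
  induction n with
  | zero => exact ⟨y, by simp, by simp⟩
  | succ n ih =>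
    obtain ⟨z, hz, hn⟩ := ih
    obtain ⟨w, hw, hn'⟩ := φ.exists_mapTheta_eq_norm_le z
    refine ⟨w, by rw [map_X_pow_succ, hw, hz], hn'.trans ?_⟩
    rw [pow_succ, ← div_div]
    gcongr

lemma exists_div_card_pow_le (c : ℝ) {R : ℝ} (hR : 0 < R) :
    ∃ n : ℕ, c / (Fintype.card F) ^ (n + 1) ≤ R := by
  have hq : (1 : ℝ) < Fintype.card F := by exact_mod_cast Fintype.one_lt_card
  obtain ⟨n, hn⟩ := pow_unbounded_of_one_lt (c / R) hq
  refine ⟨n, ?_⟩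
  rw [div_le_iff₀ (by positivity)]
  rw [div_lt_iff₀ hR] at hn
  have : (Fintype.card F : ℝ) ^ n ≤ (Fintype.card F : ℝ) ^ (n + 1) :=
    pow_le_pow_right₀ hq.le (by omega)
  nlinarith

/-- Divide y by φ_θ repeatedly until the division point w is in the small ball, write w = exp_φ(x)
there, and multiply x back by the power of θ. -/
lemma exp_surjective : Function.Surjective φ.exp := fun y => by
  obtain ⟨R, hR, -, -, h⟩ := φ.exists_ball_exp_bijOn
  obtain ⟨n, hn⟩ := exists_div_card_pow_le (F := F) ‖y‖ hR
  obtain ⟨w, hw, hwn⟩ := φ.exists_map_X_pow_eq_norm_le y (n + 1)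
  have := finiteDimensional_adjoin_simple w
  obtain ⟨x, -, -, hx⟩ := h (IntermediateField.adjoin (KInfty F) {w}) w
    (IntermediateField.mem_adjoin_simple_self _ w) (hwn.trans hn)
  exact ⟨algebraMap F[X] (KInftyBar F) (Polynomial.X ^ (n + 1)) * x, by rw [exp_mul, hx, hw]⟩

/-! ### The two inclusions -/

lemma torsion_subset_adjoin_periodLattice {a : F[X]} (ha : a ≠ 0) :
    φ.torsion a ⊆ IntermediateField.adjoin (KInfty F)
      (φ.periodLattice : Set (KInftyBar F)) := fun y hy => by
  obtain ⟨x, rfl⟩ := φ.exp_surjective y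
  set l := algebraMap F[X] (KInftyBar F) a * x with hl
  have hlP : l ∈ (φ.periodLattice : Set (KInftyBar F)) := (φ.exp_mul a x).trans hy
  have := finiteDimensional_adjoin_simple l
  have hx : x ∈ IntermediateField.adjoin (KInfty F) {l} := by
    rw [← mul_div_cancel_left₀ x (algebraMap_poly_ne_zero ha), ← hl]
    exact div_mem (IntermediateField.mem_adjoin_simple_self _ l) (algebraMap_poly_mem _ a)
  exact IntermediateField.adjoin.mono _ _ _ (Set.singleton_subset_iff.2 hlP) (φ.exp_mem _ hx)

lemma exists_mem_adjoin_torsion {l : KInftyBar F} (hl : l ∈ φ.periodLattice) :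
    ∃ n : ℕ, l ∈ IntermediateField.adjoin (KInfty F) (φ.torsion (Polynomial.X ^ (n + 1))) := by
  obtain ⟨R, hR, hinj, hle, h⟩ := φ.exists_ball_exp_bijOn
  obtain ⟨n, hn⟩ := exists_div_card_pow_le (F := F) ‖l‖ hR
  refine ⟨n, ?_⟩
  set a := algebraMap F[X] (KInftyBar F) (Polynomial.X ^ (n + 1)) with ha
  have ha0 : a ≠ 0 := algebraMap_poly_ne_zero (by simp)
  have hdiv : ‖l / a‖ ≤ R := by rwa [norm_div, ha, norm_X_pow]
  have hy : φ.exp (l / a) ∈ φ.torsion (Polynomial.X ^ (n + 1)) := by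
    change φ.map _ _ = 0
    rw [← exp_mul, ← ha, mul_div_cancel₀ _ ha0]
    exact hl
  have := finiteDimensional_adjoin_simple (φ.exp (l / a))
  obtain ⟨x, hxE, hxR, hx⟩ := h (IntermediateField.adjoin (KInfty F) {φ.exp (l / a)}) _
    (IntermediateField.mem_adjoin_simple_self _ _) ((hle _ hdiv).trans hdiv)
  -- The preimage x found over K_∞(y), with y = exp_φ(l/a), must be l/a itself: both lie in the
  -- ball, hence so does their difference, and `exp_φ` has trivial kernel there.
  have hsub : ‖x - l / a‖ ≤ R := by
    rw [sub_eq_add_neg]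
    exact (IsUltrametricDist.norm_add_le_max _ _).trans (max_le hxR (by rwa [norm_neg]))
  have hxl : x = l / a := sub_eq_zero.1 <| hinj _ hsub (by rw [exp_sub, hx, sub_self])
  have hxT := IntermediateField.adjoin.mono (KInfty F) _ _ (Set.singleton_subset_iff.2 hy) hxE
  rw [← mul_div_cancel₀ l ha0, ← hxl]
  exact mul_mem (algebraMap_poly_mem _ _) hxT

lemma torsion_mono {a b : F[X]} (hab : a ∣ b) : φ.torsion a ⊆ φ.torsion b := by
  rintro x hx
  obtain ⟨c, rfl⟩ := hab
  change φ.map _ x = 0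
  rw [mul_comm, map_mul, Module.End.mul_apply, hx.out, map_zero]

end DrinfeldModule
end Drinfeld

theorem proposition2p1 {F : Type*} [Field F] [Fintype F] {r : ℕ}
    (φ : Drinfeld.DrinfeldModule F r) :
    (IntermediateField.adjoin (Drinfeld.KInfty F)
        (φ.periodLattice : Set (Drinfeld.KInftyBar F)) : Set (Drinfeld.KInftyBar F)) =
      ⋃ n : ℕ, (IntermediateField.adjoin (Drinfeld.KInfty F)
        (φ.torsion (Polynomial.X ^ (n + 1))) : Set (Drinfeld.KInftyBar F)) := by
  have hmono : Monotone fun n : ℕ => IntermediateField.adjoin (Drinfeld.KInfty F)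
      (φ.torsion (Polynomial.X ^ (n + 1))) := fun m n hmn =>
    IntermediateField.adjoin.mono _ _ _ (φ.torsion_mono (pow_dvd_pow _ (by omega)))
  -- The torsion fields form an increasing chain, so their union is their compositum and it suffices
  -- to compare generators.
  rw [← IntermediateField.coe_iSup_of_directed hmono.directed_le]
  refine congrArg _ (le_antisymm ?_ (iSup_le fun n => ?_))
  · rw [IntermediateField.adjoin_le_iff]
    intro l hl
    obtain ⟨n, hn⟩ := φ.exists_mem_adjoin_torsion hl
    exact le_iSup (fun n : ℕ => IntermediateField.adjoin (Drinfeld.KInfty F)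
      (φ.torsion (Polynomial.X ^ (n + 1)))) n hn
  · rw [IntermediateField.adjoin_le_iff]
    exact φ.torsion_subset_adjoin_periodLattice (by simp)
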